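/- Let $F=y^d+b_1(x)y^{d-1}+\cdots+b_d(x)$ be a polynomial, monic in $y$, with coefficients in $\mathbb{R}[[x]]$, and let $f=F(0,y)\in\mathbb{R}[y]$ be its reduction modulo $x$. A power series $\sigma(t)\in\mathbb{C}[[t]]$ is called a real series if all its coefficients are real. For $N\ge 1$, let $x^{1/N}$ denote the $N$-th root of $x$ with exponent $1/N$ in the field of Hahn series with rational exponents and complex coefficients (which contains all Puiseux series). (1) The polynomial $f$ can be written as $$f=\prod_{i=1}^{s}(y-r_i)^{d_i'}\ \prod_{j=1}^{l}(y-c_j)^{d_j}(y-\overline{c_j})^{d_j},$$ where $r_1,\dots,r_s$ are the distinct real roots of $f$, the complex numbers $c_1,\overline{c_1},\dots,c_l,\overline{c_l}$ are nonreal and pairwise distinct, and all exponents are positive. (2) $F$ has a Puiseux factorization: there are an integer $N\ge1$ and $\sigma_1,\dots,\sigma_d\in\mathbb{C}[[t]]$ with $F=\prod_{k=1}^{d}\bigl(y-\sigma_k(x^{1/N})\bigr)$. (3) For every factorization of $f$ as in (1), put $$f_i=(y-r_i)^{d_i'},\qquad g_j=(y-c_j)^{d_j}(y-\overline{c_j})^{d_j}=(y^2-\alpha_j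 y+\beta_j)^{d_j},$$ with $\alpha_j=c_j+\overline{c_j}$ and $\beta_j=c_j\overline{c_j}$ real. Then there are unique polynomials $F_1,\dots,F_s,G_1,\dots,G_l\in\mathbb{R}[[x]][y]$, monic in $y$, such that $$F=F_1\cdots F_s\,G_1\cdots G_l,\qquad F_i(0,y)=f_i,\quad G_j(0,y)=g_j .$$ Moreover, for every Puiseux factorization $F=\prod_{k=1}^{d}\bigl(y-\sigma_k(x^{1/N})\bigr)$ as in (2), the $d$ linear factors can be distributed among $F_1,\dots,F_s,G_1,\dots,G_l$ in such a way that each of these polynomials is the product of the linear factors assigned to it, and every factor $y-\sigma_k(x^{1/N})$ for which $\sigma_k$ is a real series is assigned to one of the $F_i$. Finally, no $G_j$ is divisible by a linear factor $y-\tau(x^{1/N})$ with $N\ge 1$ and $\tau\in\mathbb{C}[[t]]$ a real series. -/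

import Mathlib

/-- The exponents `k / N` of a power series in `x^(1/N)`. -/
def puiseuxExponent (N : ℕ+) : ℕ →+ ℚ where
  toFun k := (k : ℚ) / ((N : ℕ) : ℚ)
  map_zero' := by simp
  map_add' a b := by push_cast; ring

theorem puiseuxExponent_le_iff (N : ℕ+) (a b : ℕ) :
    puiseuxExponent N a ≤ puiseuxExponent N b ↔ a ≤ b := by
  have hN : (0 : ℚ) < ((N : ℕ) : ℚ) := by exact_mod_cast N.pos
  change (a : ℚ) / ((N : ℕ) : ℚ) ≤ (b : ℚ) / ((N : ℕ) : ℚ) ↔ a ≤ b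
  rw [div_le_div_iff_of_pos_right hN, Nat.cast_le]

theorem puiseuxExponent_injective (N : ℕ+) : Function.Injective (puiseuxExponent N) := by
  intro a b h
  exact le_antisymm ((puiseuxExponent_le_iff N a b).1 h.le) ((puiseuxExponent_le_iff N b a).1 h.ge)

/-- The substitution `σ(t) ↦ σ(x^(1/N))`. Puiseux series in `x` are realised inside the field of
Hahn series with rational exponents and complex coefficients, the element `x^q` being
`HahnSeries.single q 1`. The range of this map is `ℂ[[x^(1/N)]]`. -/
noncomputable def puiseux (N : ℕ+) : PowerSeries ℂ →+* HahnSeries ℚ ℂ :=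
  (HahnSeries.embDomainRingHom (R := ℂ) (puiseuxExponent N) (puiseuxExponent_injective N)
    (puiseuxExponent_le_iff N)).comp
    (HahnSeries.toPowerSeries (R := ℂ)).symm.toRingHom

/-- The coefficient of `x^(k/N)` in `σ(x^(1/N))` is the coefficient of `t^k` in `σ(t)`. -/
theorem puiseux_coeff (N : ℕ+) (σ : PowerSeries ℂ) (k : ℕ) :
    (puiseux N σ).coeff ((k : ℚ) / ((N : ℕ) : ℚ)) = PowerSeries.coeff k σ := by
  have h := HahnSeries.embDomain_coeff
    (f := ⟨⟨puiseuxExponent N, puiseuxExponent_injective N⟩,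
      fun {a b} => puiseuxExponent_le_iff N a b⟩)
    (x := (HahnSeries.toPowerSeries (R := ℂ)).symm σ) (a := k)
  exact h.trans (HahnSeries.coeff_toPowerSeries_symm)

/-- The inclusion of `ℝ[[x]]` into the Hahn series with rational exponents. -/
noncomputable def realPowerSeriesToHahn : PowerSeries ℝ →+* HahnSeries ℚ ℂ :=
  (HahnSeries.ofPowerSeries ℚ ℂ).comp (PowerSeries.map Complex.ofRealHom)

/-- A real series: all coefficients of `σ(t)` are real. -/
def IsRealSeries (σ : PowerSeries ℂ) : Prop :=
  ∀ k : ℕ, (PowerSeries.coeff k σ).im = 0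

/-- Reduction modulo `x` of a polynomial in `ℝ[[x]][y]`: `F(x, y) ↦ F(0, y)`. -/
noncomputable def reductionModX (F : Polynomial (PowerSeries ℝ)) : Polynomial ℝ :=
  F.map (PowerSeries.constantCoeff (R := ℝ))

/-- The factor `(y - r)^m` of a real root. -/
noncomputable def realRootFactor (r : ℝ) (m : ℕ) : Polynomial ℝ :=
  (Polynomial.X - Polynomial.C r) ^ m

/-- The factor `(y² - α y + β)^n` of a pair `c, c̄`, with `α = c + c̄` and `β = c c̄`. -/
noncomputable def conjPairFactor (c : ℂ) (n : ℕ) : Polynomial ℝ :=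
  (Polynomial.X ^ 2 - Polynomial.C (2 * c.re) * Polynomial.X
    + Polynomial.C (Complex.normSq c)) ^ n

/-- `(y² - α y + β)^n = (y - c)^n (y - c̄)^n`. -/
theorem conjPairFactor_map (c : ℂ) (n : ℕ) :
    (conjPairFactor c n).map Complex.ofRealHom =
      (Polynomial.X - Polynomial.C c) ^ n *
        (Polynomial.X - Polynomial.C (starRingEnd ℂ c)) ^ n := by
  have h1 : ((2 * c.re : ℝ) : ℂ) = c + starRingEnd ℂ c := (Complex.add_conj c).symm
  have h2 : ((Complex.normSq c : ℝ) : ℂ) = c * starRingEnd ℂ c := (Complex.mul_conj c).symm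
  rw [conjPairFactor, ← mul_pow, Polynomial.map_pow]
  congr 1
  simp only [Polynomial.map_add, Polynomial.map_sub, Polynomial.map_mul, Polynomial.map_pow,
    Polynomial.map_X, Polynomial.map_C, Complex.ofRealHom_eq_coe, h1, h2]
  rw [Polynomial.C_add, Polynomial.C_mul]
  ring

/-- `f = ∏ (y - r i)^(m i) · ∏ (y - c j)^(n j) (y - c̄ j)^(n j)` in `ℂ[y]`, where the `r i` are the
distinct real roots of `f`, and the `c j` are nonreal roots, exactly one from each pair of
conjugate nonreal roots. -/
structure IsRootFactorization (f : Polynomial ℝ) {s l : ℕ} (r : Fin s → ℝ) (m : Fin s → ℕ)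
    (c : Fin l → ℂ) (n : Fin l → ℕ) : Prop where
  real_injective : Function.Injective r
  real_mult_pos : ∀ i, 0 < m i
  nonreal : ∀ j, (c j).im ≠ 0
  nonreal_injective : Function.Injective c
  not_conj : ∀ j k, c j ≠ starRingEnd ℂ (c k)
  nonreal_mult_pos : ∀ j, 0 < n j
  factorization : f.map Complex.ofRealHom =
    (∏ i, (Polynomial.X - Polynomial.C (r i : ℂ)) ^ m i) *
      ∏ j, ((Polynomial.X - Polynomial.C (c j)) ^ n j *
        (Polynomial.X - Polynomial.C (starRingEnd ℂ (c j))) ^ n j)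

/-- `F = F₁ ⋯ F_s G₁ ⋯ G_l` is a factorization into monic polynomials in `ℝ[[x]][y]` which lifts the
factorization `f₁ ⋯ f_s g₁ ⋯ g_l` of the reduction, `f_i = (y - r i)^(m i)` and
`g_j = (y - c j)^(n j) (y - c̄ j)^(n j)`. -/
structure IsHenselLift (F : Polynomial (PowerSeries ℝ)) {s l : ℕ} (r : Fin s → ℝ) (m : Fin s → ℕ)
    (c : Fin l → ℂ) (n : Fin l → ℕ) (Fs : Fin s → Polynomial (PowerSeries ℝ))
    (Gs : Fin l → Polynomial (PowerSeries ℝ)) : Prop where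
  monic_real : ∀ i, (Fs i).Monic
  monic_nonreal : ∀ j, (Gs j).Monic
  reduction_real : ∀ i, reductionModX (Fs i) = realRootFactor (r i) (m i)
  reduction_nonreal : ∀ j, reductionModX (Gs j) = conjPairFactor (c j) (n j)
  factorization : F = (∏ i, Fs i) * ∏ j, Gs j

/-- `H = ∏_{k ∈ A} (y - σ_k(x^(1/N)))`, an identity of polynomials over the Hahn series. -/
def IsPuiseuxProduct {d : ℕ} (H : Polynomial (PowerSeries ℝ)) (N : ℕ+)
    (σ : Fin d → PowerSeries ℂ) (A : Finset (Fin d)) : Prop :=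
  H.map realPowerSeriesToHahn = ∏ k ∈ A, (Polynomial.X - Polynomial.C (puiseux N (σ k)))

/-! Two principles over power series rings carry the proof. Coprimality of monic polynomials can be
tested on reductions, because the resultant is a unit as soon as its constant term is. Hence two
monic factorizations whose factors with different indices have coprime reductions coincide
(`eq_of_prod_eq_prod_of_isCoprime`). Existence of a lift is Hensel's lemma
(`exists_hensel_lift_prod`), applied to the `f_i` and `g_j`, no two of which share a complex root.

Puiseux factorizations come from induction on the degree. Remove the term in `y^(d-1)` and rescale
along the smallest Newton slope. The reduction is then neither `z^d` nor, in characteristic zero,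
any power of a linear polynomial. It splits into coprime factors of smaller degree, which Hensel's
lemma lifts.

For the distribution, put `x = t^N` and work over `ℂ[[t]]`. Each `σ_k(0)` is a root of exactly one
factor of `f`, and `y - σ_k` is assigned to it. The resulting groups and the lifted factors are two
factorizations of the kind above, so they agree. A real series has a real constant term, which is no
root of any `g_j`. -/

namespace Polynomial

/-! ### Coprimality and uniqueness of factorizations -/

section CoprimeLift

variable {R S ι : Type*} [CommRing R] [CommRing S]

/-- Coprimality of two polynomials, one of them monic, lifts along a local homomorphism. -/
theorem isCoprime_of_isCoprime_map (φ : R →+* S) [IsLocalHom φ] [Nontrivial S] {f g : R[X]}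
    (hf : f.Monic) (hg : g.Monic) (h : IsCoprime (f.map φ) (g.map φ)) : IsCoprime f g := by
  -- The resultant commutes with `φ`, and a local homomorphism reflects units.
  rw [← isUnit_resultant_iff_isCoprime (hf.map φ), hf.natDegree_map, hg.natDegree_map,
    resultant_map_map] at h
  exact (isUnit_resultant_iff_isCoprime hf).1 (isUnit_of_map_unit φ _ h)

/-- Two factorizations into monic factors agree if factors with different indices are coprime. -/
theorem eq_of_prod_eq_prod_of_isCoprime [Fintype ι] {P Q : ι → R[X]} (hP : ∀ i, (P i).Monic)
    (hQ : ∀ i, (Q i).Monic) (hPQ : ∀ i j, i ≠ j → IsCoprime (P i) (Q j))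
    (h : ∏ i, P i = ∏ i, Q i) : P = Q := by
  classical
  have key : ∀ (P Q : ι → R[X]), (∀ i j, i ≠ j → IsCoprime (P i) (Q j)) →
      ∏ i, P i = ∏ i, Q i → ∀ i, P i ∣ Q i := by
    intro P Q hPQ h i
    have h1 : P i ∣ ∏ i, Q i := h ▸ Finset.dvd_prod_of_mem P (Finset.mem_univ i)
    rw [← Finset.mul_prod_erase _ Q (Finset.mem_univ i)] at h1
    refine IsCoprime.dvd_of_dvd_mul_right (IsCoprime.prod_right fun j hj => ?_) h1
    exact hPQ i j (Finset.ne_of_mem_erase hj).symm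
  funext i
  have h1 := key P Q hPQ h i
  have h2 := key Q P (fun i j hij => (hPQ j i hij.symm).symm) h.symm i
  -- `R` need not be a domain: monic polynomials are regular, so the two cofactors are mutually
  -- inverse.
  exact (eq_of_monic_of_associated (hP i) (hQ i) (by
    obtain ⟨a, ha⟩ := h1
    obtain ⟨b, hb⟩ := h2
    have hab : P i * 1 = P i * (a * b) := by rw [← mul_assoc, ← ha, ← hb, mul_one]
    have hu : a * b = 1 := ((hP i).isRegular.left hab).symm
    exact ⟨⟨a, b, hu, by rw [mul_comm, hu]⟩, ha.symm⟩))

end CoprimeLift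

/-! ### Hensel's lemma over `K[[x]]` -/

section Hensel

variable {K : Type*} [Field K]

/-- This is the linear equation solved at each order in Hensel's lemma. Reducing one Bézout cofactor
modulo `g` gives the first degree bound; comparing degrees in the equation forces the second. -/
theorem exists_mul_add_mul_eq_of_isCoprime {g h : K[X]} (hg : g.Monic) (hh : h.Monic)
    (hgh : IsCoprime g h) {e : K[X]} (he : e.degree < (g * h).degree) :
    ∃ a b : K[X], a.degree < g.degree ∧ b.degree < h.degree ∧ a * h + g * b = e := by
  obtain ⟨u, v, huv⟩ := hgh
  have h1 : (e * v) %ₘ g + g * ((e * v) /ₘ g) = e * v := modByMonic_add_div _ g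
  have h3 : (e * v) %ₘ g * h + g * (e * u + (e * v) /ₘ g * h) = e := by
    linear_combination h * h1 + e * huv
  refine ⟨(e * v) %ₘ g, e * u + (e * v) /ₘ g * h, degree_modByMonic_lt _ hg, ?_, h3⟩
  have h4 : g * (e * u + (e * v) /ₘ g * h) = e - (e * v) %ₘ g * h := by linear_combination h3
  have h5 : (g * (e * u + (e * v) /ₘ g * h)).degree < (g * h).degree := by
    rw [h4]
    refine (degree_sub_le _ _).trans_lt (max_lt he ?_)
    rw [hh.degree_mul, hh.degree_mul]
    exact WithBot.add_lt_add_right (degree_ne_bot.2 hh.ne_zero) (degree_modByMonic_lt _ hg)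
  rw [degree_mul, degree_mul] at h5
  exact lt_of_add_lt_add_left h5

/-- Exchange of the variables, `K[[x]][y] → K[y][[x]]`. -/
noncomputable def toPowerSeriesPolynomial : (PowerSeries K)[X] →+* PowerSeries K[X] :=
  eval₂RingHom (PowerSeries.map C) (PowerSeries.C X)

theorem coeff_toPowerSeriesPolynomial (F : (PowerSeries K)[X]) (i k : ℕ) :
    (PowerSeries.coeff k (toPowerSeriesPolynomial F)).coeff i = PowerSeries.coeff k (F.coeff i) := by
  induction F using Polynomial.induction_on' with
  | add p q hp hq => simp [hp, hq]
  | monomial n a =>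
    rw [toPowerSeriesPolynomial, coe_eval₂RingHom, eval₂_monomial, ← map_pow,
      PowerSeries.coeff_mul_C, PowerSeries.coeff_map, coeff_C_mul, coeff_X_pow, coeff_monomial]
    by_cases h : i = n
    · simp [h]
    · simp [h, Ne.symm h]

theorem toPowerSeriesPolynomial_injective :
    Function.Injective (toPowerSeriesPolynomial : (PowerSeries K)[X] →+* PowerSeries K[X]) := by
  intro F G h
  ext i k
  rw [← coeff_toPowerSeriesPolynomial, ← coeff_toPowerSeriesPolynomial, h]

/-- A power series of polynomials whose coefficients are bounded in degree by the constant one,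
which is monic, comes from a monic polynomial over the power series. -/
theorem exists_monic_toPowerSeriesPolynomial_eq (a : ℕ → K[X]) (h0 : (a 0).Monic)
    (ha : ∀ k, (a (k + 1)).degree < (a 0).degree) :
    ∃ G : (PowerSeries K)[X], G.Monic ∧ G.map (PowerSeries.constantCoeff (R := K)) = a 0 ∧
      toPowerSeriesPolynomial G = PowerSeries.mk a := by
  set G : (PowerSeries K)[X] := ∑ i ∈ Finset.range ((a 0).natDegree + 1),
    monomial i (PowerSeries.mk fun k => (a k).coeff i) with hG
  have hdeg : ∀ k i, (a 0).natDegree < i → (a k).coeff i = 0 := by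
    intro k i hi
    rcases k with _ | k
    · exact coeff_eq_zero_of_natDegree_lt hi
    · exact coeff_eq_zero_of_degree_lt ((ha k).trans (degree_le_natDegree.trans_lt (by simpa)))
  have hc : ∀ i, G.coeff i = PowerSeries.mk fun k => (a k).coeff i := by
    intro i
    rw [hG, finsetSum_coeff]
    simp only [coeff_monomial, Finset.sum_ite_eq', Finset.mem_range]
    split_ifs with hi
    · rfl
    · ext k
      simp [hdeg k i (by omega)]
  refine ⟨G, ?_, ?_, ?_⟩
  · refine monic_of_natDegree_le_of_coeff_eq_one (a 0).natDegree ?_ ?_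
    · refine natDegree_le_iff_coeff_eq_zero.2 fun i hi => ?_
      rw [hc]
      ext k
      simp [hdeg k i hi]
    · rw [hc]
      ext k
      rcases k with _ | k
      · simp [h0]
      · have h1 := coeff_eq_zero_of_degree_lt
          ((ha k).trans_eq (degree_eq_natDegree h0.ne_zero))
        simp [h1, PowerSeries.coeff_one]
  · ext i
    simp [hc, ← PowerSeries.coeff_zero_eq_constantCoeff_apply]
  · ext k i
    rw [coeff_toPowerSeriesPolynomial, hc, PowerSeries.coeff_mk, PowerSeries.coeff_mk]

/-- The sequence of coefficients with `u 0 = p` and `u (n + 1)` obtained by applying `step` to the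
`(n + 1)`-st coefficient of `c - (∑ u k x ^ k).1 * (∑ u k x ^ k).2`, extreme terms omitted. -/
noncomputable def henselSeq (p : K[X] × K[X]) (c : ℕ → K[X]) (step : K[X] → K[X] × K[X]) :
    ℕ → K[X] × K[X]
  | 0 => p
  | n + 1 => step (c (n + 1) - ∑ i : Fin n, (henselSeq p c step (i + 1)).1 *
      (henselSeq p c step (n - i)).2)
  decreasing_by all_goals omega

/-- Hensel's lemma for a factorization of the reduction into two factors. -/
theorem exists_hensel_lift_mul {F : (PowerSeries K)[X]} (hF : F.Monic) {g h : K[X]} (hg : g.Monic)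
    (hh : h.Monic) (hgh : IsCoprime g h)
    (hFgh : F.map (PowerSeries.constantCoeff (R := K)) = g * h) :
    ∃ G H : (PowerSeries K)[X], G.Monic ∧ H.Monic ∧
      G.map (PowerSeries.constantCoeff (R := K)) = g ∧
      H.map (PowerSeries.constantCoeff (R := K)) = h ∧ F = G * H := by
  have hstep : ∀ e : K[X], ∃ ab : K[X] × K[X], e.degree < (g * h).degree →
      ab.1.degree < g.degree ∧ ab.2.degree < h.degree ∧ ab.1 * h + g * ab.2 = e := by
    intro e
    by_cases he : e.degree < (g * h).degree
    · obtain ⟨a, b, hab⟩ := exists_mul_add_mul_eq_of_isCoprime hg hh hgh he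
      exact ⟨(a, b), fun _ => hab⟩
    -- A default value that makes `step` total; the recursion only meets errors of small degree.
    · exact ⟨0, fun h => absurd h he⟩
  choose step hstep using hstep
  set c : ℕ → K[X] := fun k => PowerSeries.coeff k (toPowerSeriesPolynomial F) with hc
  have hc0 : c 0 = g * h := by
    rw [← hFgh]
    ext i
    rw [hc, coeff_toPowerSeriesPolynomial, coeff_map, PowerSeries.coeff_zero_eq_constantCoeff_apply]
  have hcdeg : ∀ k, (c (k + 1)).degree < (g * h).degree := by
    intro k
    have hd : F.natDegree = (g * h).natDegree := by rw [← hFgh, hF.natDegree_map]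
    rw [degree_eq_natDegree (hg.mul hh).ne_zero, degree_lt_iff_coeff_zero]
    intro i hi
    rw [hc, coeff_toPowerSeriesPolynomial]
    rcases hi.eq_or_lt with rfl | hi
    · rw [← hd, hF.coeff_natDegree, PowerSeries.coeff_one, if_neg k.succ_ne_zero]
    · rw [coeff_eq_zero_of_natDegree_lt (hd ▸ hi), map_zero]
  set u := henselSeq (g, h) c step with hu
  have hu0 : u 0 = (g, h) := by rw [hu, henselSeq]
  have hus : ∀ n, u (n + 1) = step (c (n + 1) - ∑ i : Fin n, (u (i + 1)).1 * (u (n - i)).2) := by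
    intro n
    rw [hu, henselSeq]
  -- The degree bounds must be carried along: those of the earlier terms keep the next error below
  -- `deg (g * h)`, where `step` solves the equation.
  have hdeg : ∀ n, (u (n + 1)).1.degree < g.degree ∧ (u (n + 1)).2.degree < h.degree ∧
      (u (n + 1)).1 * h + g * (u (n + 1)).2 =
        c (n + 1) - ∑ i : Fin n, (u (i + 1)).1 * (u (n - i)).2 := by
    intro n
    induction n using Nat.strong_induction_on with
    | _ n ih =>
      rw [hus]
      refine hstep _ ((degree_sub_le _ _).trans_lt (max_lt (hcdeg n) ?_))
      refine (degree_sum_le _ _).trans_lt ((Finset.sup_lt_iff ?_).2 fun i _ => ?_)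
      · exact bot_lt_iff_ne_bot.2 (degree_ne_bot.2 (hg.mul hh).ne_zero)
      · have h1 := (ih i i.2).1
        have h2 := (ih (n - i - 1) (by omega)).2.1
        rw [Nat.sub_add_cancel (by omega)] at h2
        refine (degree_mul_le _ _).trans_lt ?_
        rw [degree_mul]
        exact (add_le_add le_rfl h2.le).trans_lt
          (WithBot.add_lt_add_right (degree_ne_bot.2 hh.ne_zero) h1)
  obtain ⟨G, hG, hG0, hG'⟩ := exists_monic_toPowerSeriesPolynomial_eq (fun k => (u k).1)
    (by simpa [hu0]) (fun k => by simpa [hu0] using (hdeg k).1)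
  obtain ⟨H, hH, hH0, hH'⟩ := exists_monic_toPowerSeriesPolynomial_eq (fun k => (u k).2)
    (by simpa [hu0]) (fun k => by simpa [hu0] using (hdeg k).2.1)
  refine ⟨G, H, hG, hH, by simpa [hu0] using hG0, by simpa [hu0] using hH0, ?_⟩
  apply toPowerSeriesPolynomial_injective
  rw [map_mul, hG', hH']
  refine PowerSeries.ext fun n => ?_
  rw [PowerSeries.coeff_mul, Finset.Nat.sum_antidiagonal_eq_sum_range_succ_mk]
  simp only [PowerSeries.coeff_mk]
  rcases n with _ | n
  · change c 0 = _
    simp [hc0, hu0]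
  -- The two extreme terms of the Cauchy product form the left side of the equation solved by
  -- `step`; the rest is the sum subtracted there.
  · rw [Finset.sum_range_succ, Finset.sum_range_succ', ← Fin.sum_univ_eq_sum_range
      (fun i => (u (i + 1)).1 * (u (n + 1 - (i + 1))).2)]
    simp only [Nat.add_sub_add_right, Nat.sub_zero, Nat.sub_self, hu0]
    change c (n + 1) = _
    linear_combination -(hdeg n).2.2

/-- Hensel's lemma for a factorization of the reduction into pairwise coprime factors. -/
theorem exists_hensel_lift_prod {ι : Type*} (s : Finset ι) {F : (PowerSeries K)[X]} (hF : F.Monic)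
    {p : ι → K[X]} (hp : ∀ i ∈ s, (p i).Monic)
    (hcop : (s : Set ι).Pairwise fun i j => IsCoprime (p i) (p j))
    (h : F.map (PowerSeries.constantCoeff (R := K)) = ∏ i ∈ s, p i) :
    ∃ P : ι → (PowerSeries K)[X], (∀ i ∈ s, (P i).Monic ∧
      (P i).map (PowerSeries.constantCoeff (R := K)) = p i) ∧ F = ∏ i ∈ s, P i := by
  classical
  induction s using Finset.induction_on generalizing F with
  | empty =>
    refine ⟨fun _ => 1, by simp, ?_⟩
    rw [Finset.prod_empty] at h ⊢
    refine eq_one_of_monic_natDegree_zero hF ?_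
    rw [← hF.natDegree_map (PowerSeries.constantCoeff (R := K)), h, natDegree_one]
  | insert i s hi ih =>
    rw [Finset.prod_insert hi] at h
    have hps : ∀ j ∈ s, (p j).Monic := fun j hj => hp j (Finset.mem_insert_of_mem hj)
    obtain ⟨G, H, hG, hH, hG0, hH0, hGH⟩ := exists_hensel_lift_mul hF
      (hp i (Finset.mem_insert_self i s)) (monic_prod_of_monic s p hps)
      (IsCoprime.prod_right fun j hj => hcop (by simp) (by simp [hj])
        (ne_of_mem_of_not_mem hj hi).symm) h
    obtain ⟨P, hP, hHP⟩ := ih hH hps (hcop.mono (by simp)) hH0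
    have hne : ∀ j ∈ s, Function.update P i G j = P j := fun j hj =>
      Function.update_of_ne (ne_of_mem_of_not_mem hj hi) _ _
    refine ⟨Function.update P i G, fun j hj => ?_, ?_⟩
    · rcases Finset.mem_insert.1 hj with rfl | hj
      · simpa using ⟨hG, hG0⟩
      · rw [hne j hj]
        exact hP j hj
    · rw [Finset.prod_insert hi, Function.update_self, Finset.prod_congr rfl hne, ← hHP, hGH]

end Hensel

end Polynomial

/-! ### The Newton–Puiseux theorem -/

namespace Polynomial

section Tschirnhaus

/-- This coefficient is the value at `r` of the Hasse derivative of order `d - 1`, which is linear.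
-/
theorem Monic.nextCoeff_taylor {R : Type*} [CommRing R] [Nontrivial R] {f : R[X]} (hf : f.Monic)
    (hd : 0 < f.natDegree) (r : R) :
    (taylor r f).nextCoeff = f.natDegree * r + f.nextCoeff := by
  obtain ⟨n, hn⟩ : ∃ n, f.natDegree = n + 1 := ⟨f.natDegree - 1, by omega⟩
  rw [nextCoeff_of_natDegree_pos (by rwa [natDegree_taylor]), nextCoeff_of_natDegree_pos hd,
    natDegree_taylor, taylor_coeff]
  have h1 : (hasseDeriv (f.natDegree - 1) f).natDegree ≤ 1 :=
    (natDegree_hasseDeriv_le _ _).trans (by omega)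
  have h2 : f.coeff (n + 1) = 1 := hn ▸ hf
  rw [eq_X_add_C_of_natDegree_le_one h1]
  simp [hasseDeriv_coeff, hn, add_comm 1 n, h2]

end Tschirnhaus

section AlgClosed

variable {K : Type*} [Field K] [IsAlgClosed K] [CharZero K]

/-- Split off the full power of `X - a` at a root `a`. If nothing else remained, the next
coefficient would be `-d * a`, forcing `a = 0` in characteristic zero. -/
theorem exists_isCoprime_mul_eq_of_nextCoeff_eq_zero {g : K[X]} (hg : g.Monic)
    (hd : 0 < g.natDegree) (hnext : g.nextCoeff = 0) (hne : g ≠ X ^ g.natDegree) :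
    ∃ p q : K[X], p.Monic ∧ q.Monic ∧ IsCoprime p q ∧ g = p * q ∧
      p.natDegree < g.natDegree ∧ q.natDegree < g.natDegree := by
  obtain ⟨a, ha⟩ := IsAlgClosed.exists_root g (natDegree_pos_iff_degree_pos.1 hd).ne'
  obtain ⟨q, hq, hqa⟩ := exists_eq_pow_rootMultiplicity_mul_and_not_dvd g hg.ne_zero a
  set m := g.rootMultiplicity a
  have hm : 0 < m := (rootMultiplicity_pos hg.ne_zero).2 ha
  have hp : ((X - C a) ^ m).Monic := (monic_X_sub_C a).pow m
  have hqm : q.Monic := hp.of_mul_monic_left (hq ▸ hg)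
  have hdeg : g.natDegree = m + q.natDegree := by
    conv_lhs => rw [hq, hp.natDegree_mul hqm, natDegree_pow, natDegree_X_sub_C, mul_one]
  have hpd : ((X - C a) ^ m).natDegree = m := by rw [natDegree_pow, natDegree_X_sub_C, mul_one]
  refine ⟨(X - C a) ^ m, q, hp, hqm, ?_, hq, ?_, by omega⟩
  · exact (((irreducible_X_sub_C a).coprime_iff_not_dvd).2 hqa).pow_left
  · rw [hpd, hdeg]
    by_contra hcon
    have hq1 : q = 1 := eq_one_of_monic_natDegree_zero hqm (by omega)
    rw [hq1, mul_one] at hq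
    rw [hq, (monic_X_sub_C a).nextCoeff_pow, nextCoeff_X_sub_C, nsmul_eq_mul, mul_neg, neg_eq_zero,
      mul_eq_zero] at hnext
    have ha0 : a = 0 := hnext.resolve_left (by exact_mod_cast hm.ne')
    apply hne
    conv_lhs => rw [hq, ha0, C_0, sub_zero]
    rw [hdeg, hq1, natDegree_one, add_zero]

end AlgClosed

section ScaleRoots

theorem Monic.exists_scaleRoots_eq {R : Type*} [CommRing R] {f : R[X]} (hf : f.Monic) {s : R}
    (h : ∀ j ≤ f.natDegree, s ^ (f.natDegree - j) ∣ f.coeff j) :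
    ∃ g : R[X], g.Monic ∧ g.natDegree = f.natDegree ∧ g.scaleRoots s = f := by
  nontriviality R
  choose! c hc using h
  set g : R[X] := X ^ f.natDegree + ∑ j ∈ Finset.range f.natDegree, monomial j (c j) with hg
  have hlt : (∑ j ∈ Finset.range f.natDegree, monomial j (c j)).degree < f.natDegree := by
    rw [degree_lt_iff_coeff_zero]
    intro i hi
    simp only [finsetSum_coeff, coeff_monomial, Finset.sum_ite_eq', Finset.mem_range]
    rw [if_neg (by omega)]
  have hgm : g.Monic := monic_X_pow_add hlt
  have hgd : g.natDegree = f.natDegree := by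
    rw [hg, natDegree_add_eq_left_of_degree_lt (by rwa [degree_X_pow]), natDegree_X_pow]
  refine ⟨g, hgm, hgd, ?_⟩
  ext i
  rw [coeff_scaleRoots, hgd]
  rcases lt_trichotomy i f.natDegree with hi | rfl | hi
  · rw [hc i hi.le, hg]
    simp [coeff_X_pow, hi.ne, finsetSum_coeff, coeff_monomial, hi, mul_comm]
  · rw [← hgd, hgm.coeff_natDegree, hgd, hf.coeff_natDegree]
    simp
  · rw [coeff_eq_zero_of_natDegree_lt hi, coeff_eq_zero_of_natDegree_lt (hgd ▸ hi), zero_mul]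

end ScaleRoots

section NewtonPuiseux

variable {K : Type*} [Field K]

instance : IsLocalHom (PowerSeries.constantCoeff (R := K)) :=
  ⟨fun _ h => PowerSeries.isUnit_iff_constantCoeff.2 h⟩

/-- After a substitution `x = t ^ q`, `y = t ^ p z`, a polynomial other than `y ^ d` has a reduction
other than `z ^ d`. -/
theorem exists_scaleRoots_eq_map_expand {F : (PowerSeries K)[X]} (hF : F.Monic)
    (hne : F ≠ X ^ F.natDegree) :
    ∃ (q : ℕ) (hq : q ≠ 0) (p : ℕ) (G : (PowerSeries K)[X]), G.Monic ∧
      G.natDegree = F.natDegree ∧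
      G.scaleRoots (PowerSeries.X ^ p) = F.map (PowerSeries.expand q hq).toRingHom ∧
      G.map (PowerSeries.constantCoeff (R := K)) ≠ X ^ F.natDegree := by
  set d := F.natDegree with hd
  classical
  -- Zero coefficients are left out because `toNat` would turn their infinite order into `0`.
  set I := (Finset.range d).filter fun j => F.coeff j ≠ 0 with hI
  have hIne : I.Nonempty := by
    by_contra hcon
    rw [Finset.not_nonempty_iff_eq_empty, Finset.filter_eq_empty_iff] at hcon
    apply hne
    ext1 j
    rw [coeff_X_pow]
    rcases lt_trichotomy j d with hj | rfl | hj
    · rw [if_neg hj.ne]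
      simpa using hcon (Finset.mem_range.2 hj)
    · rw [if_pos rfl, hd, hF.coeff_natDegree]
    · rw [if_neg hj.ne', coeff_eq_zero_of_natDegree_lt hj]
  -- The smallest Newton slope is `p / q` with `q = d - j₀`, not necessarily in lowest terms.
  -- Minimality makes `t^(p (d - j))` divide the `j`-th coefficient after `x = t^q`.
  obtain ⟨j₀, hj₀, hmin⟩ := I.exists_min_image
    (fun j => ((F.coeff j).order.toNat : ℚ) / ((d - j : ℕ) : ℚ)) hIne
  obtain ⟨hj₀d, hj₀0⟩ := Finset.mem_filter.1 hj₀
  rw [Finset.mem_range] at hj₀d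
  set p := (F.coeff j₀).order.toNat with hp
  have hq : d - j₀ ≠ 0 := by omega
  set E := (PowerSeries.expand (R := K) (d - j₀) hq).toRingHom with hE
  have hEX : ∀ n : ℕ, E (PowerSeries.X ^ n) = PowerSeries.X ^ ((d - j₀) * n) := by
    intro n
    rw [map_pow, pow_mul]
    congr 1
    exact PowerSeries.expand_X _ _
  have hEd : (F.map E).natDegree = d := hF.natDegree_map E
  have hdvd : ∀ j ≤ (F.map E).natDegree,
      (PowerSeries.X ^ p : PowerSeries K) ^ ((F.map E).natDegree - j) ∣ (F.map E).coeff j := by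
    intro j hj
    rw [hEd] at hj ⊢
    rw [coeff_map, ← pow_mul]
    rcases hj.eq_or_lt with rfl | hj
    · simp
    by_cases h0 : F.coeff j = 0
    · simp [h0]
    have h1 := hmin j (Finset.mem_filter.2 ⟨Finset.mem_range.2 hj, h0⟩)
    rw [div_le_div_iff₀ (by exact_mod_cast (by omega)) (by exact_mod_cast (by omega))] at h1
    have h2 : p * (d - j) ≤ (F.coeff j).order.toNat * (d - j₀) := by exact_mod_cast h1
    have h3 : E (PowerSeries.X ^ (F.coeff j).order.toNat) ∣ E (F.coeff j) :=
      _root_.map_dvd E PowerSeries.X_pow_order_dvd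
    rw [hEX] at h3
    exact (pow_dvd_pow _ (by rwa [mul_comm (d - j₀)])).trans h3
  obtain ⟨G, hG, hGd, hGs⟩ := (hF.map E).exists_scaleRoots_eq hdvd
  refine ⟨d - j₀, hq, p, G, hG, hGd.trans hEd, hGs, fun hcon => ?_⟩
  have h1 := congrArg (coeff · j₀) hGs
  simp only [coeff_scaleRoots, coeff_map, hGd, hEd] at h1
  -- At `j₀` the divisibility is sharp: one more factor `t` would kill the leading coefficient of
  -- `F.coeff j₀`.
  have h2 : PowerSeries.constantCoeff (G.coeff j₀) = 0 := by
    rw [← coeff_map, hcon, coeff_X_pow, if_neg hj₀d.ne]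
  obtain ⟨c, hc⟩ := PowerSeries.X_dvd_iff.2 h2
  have h3 : PowerSeries.coeff ((d - j₀) * p) (E (F.coeff j₀)) = PowerSeries.coeff p (F.coeff j₀) :=
    PowerSeries.coeff_expand_mul _ _ _ _
  refine PowerSeries.coeff_order hj₀0 ?_
  rw [← hp, ← h3, ← h1, hc, ← pow_mul, mul_comm p]
  have h4 : (PowerSeries.X : PowerSeries K) ^ ((d - j₀) * p + 1) ∣
      PowerSeries.X * c * PowerSeries.X ^ ((d - j₀) * p) := ⟨c, by ring⟩
  exact PowerSeries.X_pow_dvd_iff.1 h4 _ (Nat.lt_succ_self _)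

theorem map_expand_mul (F : (PowerSeries K)[X]) {M N : ℕ} (hM : M ≠ 0) (hN : N ≠ 0) :
    F.map (PowerSeries.expand (M * N) (mul_ne_zero hM hN)).toRingHom =
      (F.map (PowerSeries.expand N hN).toRingHom).map (PowerSeries.expand M hM).toRingHom := by
  ext1 i
  simp only [coeff_map]
  exact PowerSeries.expand_mul M hM N hN _

theorem splits_map_expand_mul {F : (PowerSeries K)[X]} {N : ℕ} {hN : N ≠ 0}
    (h : (F.map (PowerSeries.expand N hN).toRingHom).Splits) {M : ℕ} (hM : M ≠ 0) :
    (F.map (PowerSeries.expand (M * N) (mul_ne_zero hM hN)).toRingHom).Splits := by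
  rw [map_expand_mul F hM hN]
  exact h.map _

/-- The Newton–Puiseux theorem for monic polynomials. -/
theorem Monic.exists_splits_map_expand [IsAlgClosed K] [CharZero K] {F : (PowerSeries K)[X]}
    (hF : F.Monic) :
    ∃ (N : ℕ) (hN : N ≠ 0), (F.map (PowerSeries.expand N hN).toRingHom).Splits := by
  induction hd : F.natDegree using Nat.strong_induction_on generalizing F with
  | _ d ih =>
  subst hd
  rcases Nat.eq_zero_or_pos F.natDegree with h0 | hpos
  · refine ⟨1, one_ne_zero, ?_⟩
    rw [eq_one_of_monic_natDegree_zero hF h0, Polynomial.map_one]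
    exact Splits.one
  -- Tschirnhaus shift: translation by `-a` removes the term in `y^(d-1)`.
  set a : PowerSeries K := PowerSeries.C ((F.natDegree : K)⁻¹) * F.nextCoeff with ha
  have hTm : (taylor (-a) F).Monic := by rw [Monic, leadingCoeff_taylor, hF]
  have hTd : (taylor (-a) F).natDegree = F.natDegree := natDegree_taylor _ _
  have hTn : (taylor (-a) F).nextCoeff = 0 := by
    have h1 : (F.natDegree : PowerSeries K) * PowerSeries.C ((F.natDegree : K)⁻¹) = 1 := by
      rw [← map_natCast (PowerSeries.C (R := K)), ← map_mul, mul_inv_cancel₀, map_one]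
      exact_mod_cast hpos.ne'
    rw [hF.nextCoeff_taylor hpos, ha, mul_neg, ← mul_assoc, h1, one_mul, neg_add_cancel]
  suffices h : ∃ (N : ℕ) (hN : N ≠ 0),
      ((taylor (-a) F).map (PowerSeries.expand N hN).toRingHom).Splits by
    obtain ⟨N, hN, h⟩ := h
    refine ⟨N, hN, ?_⟩
    have h1 := h.taylor ((PowerSeries.expand N hN).toRingHom a)
    rwa [← map_taylor, taylor_taylor, add_neg_cancel, taylor_zero] at h1
  by_cases hX : taylor (-a) F = X ^ F.natDegree
  · refine ⟨1, one_ne_zero, ?_⟩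
    rw [hX]
    exact (Splits.X_pow _).map _
  rw [← hTd] at hX
  obtain ⟨q, hq, p, G, hG, hGd, hGs, hGne⟩ := exists_scaleRoots_eq_map_expand hTm hX
  rw [hTd] at hGd hGne
  have hGp : 0 < G.natDegree := hGd ▸ hpos
  have hgd : (G.map (PowerSeries.constantCoeff (R := K))).natDegree = F.natDegree := by
    rw [hG.natDegree_map, hGd]
  -- Rescaling multiplies this coefficient by `X^p`, a nonzero element of a domain, so its vanishing
  -- passes to `G`.
  have hGn : G.nextCoeff = 0 := by
    have h1 : (G.scaleRoots (PowerSeries.X ^ p)).nextCoeff = 0 := by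
      rw [hGs, nextCoeff_map_of_leadingCoeff_ne_zero, hTn, map_zero]
      rw [hTm.leadingCoeff, map_one]
      exact one_ne_zero
    rw [nextCoeff_of_natDegree_pos (by rwa [natDegree_scaleRoots]), natDegree_scaleRoots,
      coeff_scaleRoots, Nat.sub_sub_self hGp, pow_one] at h1
    rw [nextCoeff_of_natDegree_pos hGp]
    exact (mul_eq_zero.1 h1).resolve_right (pow_ne_zero _ PowerSeries.X_ne_zero)
  obtain ⟨g, h, hg, hh, hgh, hGgh, hgl, hhl⟩ := exists_isCoprime_mul_eq_of_nextCoeff_eq_zero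
    (hG.map (PowerSeries.constantCoeff (R := K))) (by rwa [hgd])
    (by rw [nextCoeff_map_of_leadingCoeff_ne_zero _ (by simp [hG]), hGn, map_zero])
    (by rwa [hgd])
  obtain ⟨G₁, G₂, hG₁, hG₂, rfl, rfl, rfl⟩ := exists_hensel_lift_mul hG hg hh hgh hGgh
  rw [hG₁.natDegree_map, hgd] at hgl
  rw [hG₂.natDegree_map, hgd] at hhl
  obtain ⟨N₁, hN₁, hs₁⟩ := ih _ hgl hG₁ rfl
  obtain ⟨N₂, hN₂, hs₂⟩ := ih _ hhl hG₂ rfl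
  -- The product `N₁ * N₂` serves as a common ramification index.
  have hs : ((G₁ * G₂).map
      (PowerSeries.expand (N₁ * N₂) (mul_ne_zero hN₁ hN₂)).toRingHom).Splits := by
    rw [Polynomial.map_mul]
    refine Splits.mul ?_ (splits_map_expand_mul hs₂ hN₁)
    convert splits_map_expand_mul hs₁ hN₂ using 4
    exact mul_comm _ _
  refine ⟨N₁ * N₂ * q, mul_ne_zero (mul_ne_zero hN₁ hN₂) hq, ?_⟩
  rw [map_expand_mul _ (mul_ne_zero hN₁ hN₂) hq]
  have h1 := hs.scaleRoots
    ((PowerSeries.expand (N₁ * N₂) (mul_ne_zero hN₁ hN₂)).toRingHom (PowerSeries.X ^ p))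
  rw [← map_scaleRoots _ _ _ (by rw [hG.leadingCoeff, map_one]; exact one_ne_zero), hGs] at h1
  exact h1

end NewtonPuiseux

end Polynomial

open Polynomial

/-! ### From Hahn series to `ℂ[[t]]` -/

section Hahn

theorem puiseux_coeff_of_ne (N : ℕ+) (σ : PowerSeries ℂ) {q : ℚ}
    (hq : ∀ k : ℕ, (k : ℚ) / ((N : ℕ) : ℚ) ≠ q) : (puiseux N σ).coeff q = 0 :=
  HahnSeries.embDomain_of_notMem_range
    (f := ⟨⟨puiseuxExponent N, puiseuxExponent_injective N⟩,
      fun {a b} => puiseuxExponent_le_iff N a b⟩) (fun ⟨k, hk⟩ => hq k hk)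

theorem puiseux_injective (N : ℕ+) : Function.Injective (puiseux N) := by
  intro σ τ h
  ext k
  rw [← puiseux_coeff N, ← puiseux_coeff N, h]

theorem ofPowerSeries_coeff_of_ne (σ : PowerSeries ℂ) {q : ℚ} (hq : ∀ k : ℕ, (k : ℚ) ≠ q) :
    (HahnSeries.ofPowerSeries ℚ ℂ σ).coeff q = 0 := by
  rw [HahnSeries.ofPowerSeries_apply]
  exact HahnSeries.embDomain_of_notMem_range (fun ⟨k, hk⟩ => hq k hk)

theorem puiseux_expand (N : ℕ+) (σ : PowerSeries ℂ) :
    puiseux N (PowerSeries.expand N N.ne_zero σ) = HahnSeries.ofPowerSeries ℚ ℂ σ := by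
  have hN : ((N : ℕ) : ℚ) ≠ 0 := by exact_mod_cast N.ne_zero
  ext q
  by_cases hq : ∃ k : ℕ, (k : ℚ) / ((N : ℕ) : ℚ) = q
  · obtain ⟨k, rfl⟩ := hq
    rw [puiseux_coeff, PowerSeries.coeff_expand]
    split_ifs with hk
    · obtain ⟨j, rfl⟩ := hk
      rw [Nat.mul_div_cancel_left _ N.pos, Nat.cast_mul, mul_div_cancel_left₀ _ hN]
      exact (HahnSeries.ofPowerSeries_apply_coeff σ j).symm
    · refine (ofPowerSeries_coeff_of_ne σ fun j hj => hk ⟨j, ?_⟩).symm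
      rw [eq_div_iff hN] at hj
      exact_mod_cast (mul_comm _ _).trans hj |>.symm
  · push Not at hq
    rw [puiseux_coeff_of_ne N _ hq, ofPowerSeries_coeff_of_ne]
    intro j hj
    apply hq (j * N)
    rw [Nat.cast_mul, mul_div_cancel_right₀ _ hN, hj]

/-- The substitution `x = t ^ N`, from `ℝ[[x]]` to `ℂ[[t]]`. -/
noncomputable def realExpand (N : ℕ+) : PowerSeries ℝ →+* PowerSeries ℂ :=
  (PowerSeries.expand N N.ne_zero).toRingHom.comp (PowerSeries.map Complex.ofRealHom)

theorem puiseux_comp_realExpand (N : ℕ+) :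
    (puiseux N).comp (realExpand N) = realPowerSeriesToHahn :=
  RingHom.ext fun _ => puiseux_expand N _

theorem map_map_realExpand (N : ℕ+) (H : (PowerSeries ℝ)[X]) :
    (H.map (realExpand N)).map (puiseux N) = H.map realPowerSeriesToHahn := by
  rw [map_map, puiseux_comp_realExpand]

theorem map_realExpand_map_constantCoeff (N : ℕ+) (H : (PowerSeries ℝ)[X]) :
    (H.map (realExpand N)).map (PowerSeries.constantCoeff (R := ℂ)) =
      (reductionModX H).map Complex.ofRealHom := by
  rw [map_map, reductionModX, map_map]
  congr 1
  ext1 φ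
  change PowerSeries.constantCoeff (PowerSeries.expand N N.ne_zero _) = _
  rw [PowerSeries.constantCoeff_expand, ← PowerSeries.coeff_zero_eq_constantCoeff_apply,
    PowerSeries.coeff_map, PowerSeries.coeff_zero_eq_constantCoeff_apply, RingHom.comp_apply]

/-- The inclusion of `ℝ[[x]]` factors through the injective map `puiseux N`, so the identity can be
tested over the local ring `ℂ[[t]]`, where reduction is available. -/
theorem isPuiseuxProduct_iff {d : ℕ} {H : (PowerSeries ℝ)[X]} {N : ℕ+}
    {σ : Fin d → PowerSeries ℂ} {A : Finset (Fin d)} :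
    IsPuiseuxProduct H N σ A ↔ H.map (realExpand N) = ∏ k ∈ A, (X - C (σ k)) := by
  rw [IsPuiseuxProduct, ← map_map_realExpand N,
    ← (map_injective _ (puiseux_injective N)).eq_iff (a := H.map (realExpand N)),
    Polynomial.map_prod]
  simp

theorem X_sub_C_puiseux_dvd_iff {H : (PowerSeries ℝ)[X]} {N : ℕ+} {τ : PowerSeries ℂ} :
    X - C (puiseux N τ) ∣ H.map realPowerSeriesToHahn ↔ (H.map (realExpand N)).eval τ = 0 := by
  rw [dvd_iff_isRoot, IsRoot, ← map_map_realExpand N, eval_map_apply,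
    map_eq_zero_iff _ (puiseux_injective N)]

theorem eval_constantCoeff_reductionModX (N : ℕ+) (H : (PowerSeries ℝ)[X]) (τ : PowerSeries ℂ) :
    ((reductionModX H).map Complex.ofRealHom).eval (PowerSeries.constantCoeff τ) =
      PowerSeries.constantCoeff ((H.map (realExpand N)).eval τ) := by
  rw [← map_realExpand_map_constantCoeff N, eval_map_apply]

theorem Multiset.exists_map_univ_eq {α : Type*} {d : ℕ} (m : Multiset α) (h : m.card = d) :
    ∃ σ : Fin d → α, Finset.univ.val.map σ = m := by
  subst h
  induction m using Quotient.inductionOn with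
  | h l => exact ⟨l.get, (Fin.univ_val_map l.get).trans (congrArg _ (List.ofFn_get l))⟩

theorem exists_isPuiseuxProduct {F : (PowerSeries ℝ)[X]} (hF : F.Monic) :
    ∃ (N : ℕ+) (σ : Fin F.natDegree → PowerSeries ℂ), IsPuiseuxProduct F N σ Finset.univ := by
  obtain ⟨N, hN, hs⟩ := (hF.map (PowerSeries.map Complex.ofRealHom)).exists_splits_map_expand
  rw [map_map] at hs
  change (F.map (realExpand ⟨N, Nat.pos_of_ne_zero hN⟩)).Splits at hs
  refine ⟨⟨N, Nat.pos_of_ne_zero hN⟩, ?_⟩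
  obtain ⟨σ, hσ⟩ := Multiset.exists_map_univ_eq _
    (hs.natDegree_eq_card_roots.symm.trans (hF.natDegree_map _))
  refine ⟨σ, isPuiseuxProduct_iff.2 ?_⟩
  conv_lhs => rw [hs.eq_prod_roots_of_monic (hF.map _), ← hσ, Multiset.map_map]
  rfl

end Hahn

/-! ### Real roots and conjugate pairs -/

section RootFactorization

theorem exists_isRootFactorization {f : ℝ[X]} (hf : f.Monic) :
    ∃ (s l : ℕ) (r : Fin s → ℝ) (m : Fin s → ℕ) (c : Fin l → ℂ) (n : Fin l → ℕ),
      IsRootFactorization f r m c n := by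
  classical
  set g : ℂ[X] := f.map Complex.ofRealHom with hg
  have hgm : g.Monic := hf.map _
  set S := g.roots.toFinset with hS
  set R := S.filter fun a => a.im = 0 with hR
  set U := S.filter fun a => 0 < a.im with hU
  -- Since `g` has real coefficients, conjugation preserves multiplicities. Each nonreal pair is
  -- then represented by its root in the upper half plane.
  have hconj : ∀ a, g.roots.count (starRingEnd ℂ a) = g.roots.count a := by
    intro a
    rw [count_roots, count_roots, eq_rootMultiplicity_map (starRingEnd ℂ).injective a, hg, map_map]
    congr 2
    ext1 x
    simp
  have hmem : ∀ a, a ∈ S ↔ 0 < g.roots.count a := by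
    intro a
    rw [Multiset.count_pos, hS, Multiset.mem_toFinset]
  have hprod : g = ∏ a ∈ S, (X - C a) ^ g.roots.count a := by
    conv_lhs => rw [(IsAlgClosed.splits g).eq_prod_roots_of_monic hgm,
      Finset.prod_multiset_map_count]
  have hneg : ∏ a ∈ (S.filter fun a => ¬a.im = 0).filter (fun a => ¬0 < a.im),
      (X - C a) ^ g.roots.count a = ∏ a ∈ U, (X - C (starRingEnd ℂ a)) ^ g.roots.count a := by
    refine Finset.prod_nbij' (starRingEnd ℂ) (starRingEnd ℂ) ?_ ?_ ?_ ?_ ?_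
    · intro a ha
      simp only [hU, Finset.mem_filter, hmem, hconj, Complex.conj_im] at ha ⊢
      exact ⟨ha.1.1, neg_pos.2 (lt_of_le_of_ne (not_lt.1 ha.2) ha.1.2)⟩
    · intro a ha
      simp only [hU, Finset.mem_filter, hmem, hconj, Complex.conj_im] at ha ⊢
      exact ⟨⟨ha.1, by linarith [ha.2]⟩, by linarith [ha.2]⟩
    · intro a _
      exact Complex.conj_conj a
    · intro a _
      exact Complex.conj_conj a
    · intro a _
      rw [hconj, Complex.conj_conj]
  have hpos : (S.filter fun a => ¬a.im = 0).filter (fun a => 0 < a.im) = U := by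
    rw [Finset.filter_filter]
    exact Finset.filter_congr fun a _ => ⟨fun h => h.2, fun h => ⟨h.ne', h⟩⟩
  set e := R.equivFin.symm
  set e' := U.equivFin.symm
  have he : ∀ i, (((e i : ℂ).re : ℝ) : ℂ) = (e i : ℂ) := fun i =>
    Complex.ext rfl (Finset.mem_filter.1 (e i).2).2.symm
  have he' : ∀ j, 0 < (e' j : ℂ).im := fun j => (Finset.mem_filter.1 (e' j).2).2
  refine ⟨R.card, U.card, fun i => (e i : ℂ).re, fun i => g.roots.count (e i : ℂ),
    fun j => e' j, fun j => g.roots.count (e' j : ℂ), ?_, ?_, ?_, ?_, ?_, ?_, ?_⟩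
  · intro i j hij
    apply e.injective
    apply Subtype.ext
    rw [← he i, ← he j]
    exact congrArg _ hij
  · exact fun i => (hmem _).1 (Finset.mem_filter.1 (e i).2).1
  · exact fun j => (he' j).ne'
  · exact fun i j hij => e'.injective (Subtype.ext hij)
  · intro j k hjk
    have h1 := congrArg Complex.im hjk
    rw [Complex.conj_im] at h1
    linarith [he' j, he' k]
  · exact fun j => (hmem _).1 (Finset.mem_filter.1 (e' j).2).1
  · change g = _
    conv_lhs => rw [hprod, ← Finset.prod_filter_mul_prod_filter_not S (fun a => a.im = 0),
      ← Finset.prod_filter_mul_prod_filter_not (S.filter fun a => ¬a.im = 0) (fun a => 0 < a.im),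
      hneg, hpos, ← Finset.prod_mul_distrib]
    congr 1
    · rw [← Finset.prod_coe_sort R, ← e.prod_comp]
      exact Finset.prod_congr rfl fun i _ => by rw [he]
    · rw [← Finset.prod_coe_sort U, ← e'.prod_comp]

end RootFactorization

/-! ### Lifted factors and distribution of the linear factors -/

section MainTheorem

variable {s l : ℕ} {r : Fin s → ℝ} {m : Fin s → ℕ} {c : Fin l → ℂ} {n : Fin l → ℕ}

/-- The factors `(y - r i) ^ m i` and `(y - c j) ^ n j (y - c̄ j) ^ n j`. -/
noncomputable def rootFactor (r : Fin s → ℝ) (m : Fin s → ℕ) (c : Fin l → ℂ) (n : Fin l → ℕ) :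
    Fin s ⊕ Fin l → ℝ[X] :=
  Sum.elim (fun i => realRootFactor (r i) (m i)) fun j => conjPairFactor (c j) (n j)

theorem realRootFactor_map (a : ℝ) (k : ℕ) :
    (realRootFactor a k).map Complex.ofRealHom = (X - C (a : ℂ)) ^ k := by
  simp [realRootFactor]

theorem rootFactor_monic (i : Fin s ⊕ Fin l) : (rootFactor r m c n i).Monic := by
  apply monic_of_injective Complex.ofRealHom.injective
  rcases i with i | j
  · change ((realRootFactor _ _).map _).Monic
    rw [realRootFactor_map]
    exact (monic_X_sub_C _).pow _
  · change ((conjPairFactor _ _).map _).Monic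
    rw [conjPairFactor_map]
    exact ((monic_X_sub_C _).pow _).mul ((monic_X_sub_C _).pow _)

theorem eq_of_eval_realRootFactor_eq_zero {a : ℝ} {k : ℕ} {z : ℂ}
    (h : ((realRootFactor a k).map Complex.ofRealHom).eval z = 0) : z = a := by
  rw [realRootFactor_map, eval_pow, eval_sub, eval_X, eval_C] at h
  exact sub_eq_zero.1 (eq_zero_of_pow_eq_zero h)

theorem eq_or_eq_of_eval_conjPairFactor_eq_zero {a : ℂ} {k : ℕ} {z : ℂ}
    (h : ((conjPairFactor a k).map Complex.ofRealHom).eval z = 0) :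
    z = a ∨ z = starRingEnd ℂ a := by
  rw [conjPairFactor_map, eval_mul, eval_pow, eval_pow, eval_sub, eval_sub, eval_X, eval_C,
    eval_C] at h
  exact (mul_eq_zero.1 h).imp (fun h => sub_eq_zero.1 (eq_zero_of_pow_eq_zero h))
    fun h => sub_eq_zero.1 (eq_zero_of_pow_eq_zero h)

theorem im_ne_zero_of_eval_conjPairFactor_eq_zero {a : ℂ} (ha : a.im ≠ 0) {k : ℕ} {z : ℂ}
    (h : ((conjPairFactor a k).map Complex.ofRealHom).eval z = 0) : z.im ≠ 0 := by
  rcases eq_or_eq_of_eval_conjPairFactor_eq_zero h with rfl | rfl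
  · exact ha
  · rwa [Complex.conj_im, neg_ne_zero]

theorem IsRealSeries.im_constantCoeff {σ : PowerSeries ℂ} (h : IsRealSeries σ) :
    (PowerSeries.constantCoeff σ).im = 0 := by
  rw [← PowerSeries.coeff_zero_eq_constantCoeff_apply]
  exact h 0

namespace IsRootFactorization

variable {f : ℝ[X]}

theorem eq_prod_rootFactor (h : IsRootFactorization f r m c n) :
    f = ∏ i, rootFactor r m c n i := by
  apply map_injective _ Complex.ofRealHom.injective
  rw [h.factorization, Fintype.prod_sum_type, Polynomial.map_mul, Polynomial.map_prod,
    Polynomial.map_prod]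
  simp only [rootFactor, Sum.elim_inl, Sum.elim_inr, realRootFactor_map, conjPairFactor_map]

theorem eq_of_eval_eq_zero (h : IsRootFactorization f r m c n) {i j : Fin s ⊕ Fin l} {z : ℂ}
    (hi : ((rootFactor r m c n i).map Complex.ofRealHom).eval z = 0)
    (hj : ((rootFactor r m c n j).map Complex.ofRealHom).eval z = 0) : i = j := by
  rcases i with i | i <;> rcases j with j | j
  · have h1 := eq_of_eval_realRootFactor_eq_zero hi
    rw [eq_of_eval_realRootFactor_eq_zero hj] at h1
    rw [h.real_injective (Complex.ofReal_injective h1)]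
  · refine absurd ?_ (im_ne_zero_of_eval_conjPairFactor_eq_zero (h.nonreal j) hj)
    rw [eq_of_eval_realRootFactor_eq_zero hi, Complex.ofReal_im]
  · refine absurd ?_ (im_ne_zero_of_eval_conjPairFactor_eq_zero (h.nonreal i) hi)
    rw [eq_of_eval_realRootFactor_eq_zero hj, Complex.ofReal_im]
  · congr 1
    rcases eq_or_eq_of_eval_conjPairFactor_eq_zero hi with h1 | h1 <;>
      rcases eq_or_eq_of_eval_conjPairFactor_eq_zero hj with h2 | h2 <;> rw [h1] at h2
    · exact h.nonreal_injective h2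
    · exact absurd h2 (h.not_conj _ _)
    · exact absurd h2.symm (h.not_conj _ _)
    · exact h.nonreal_injective ((starRingEnd ℂ).injective h2)

theorem isCoprime_rootFactor (h : IsRootFactorization f r m c n) {i j : Fin s ⊕ Fin l}
    (hij : i ≠ j) : IsCoprime (rootFactor r m c n i) (rootFactor r m c n j) := by
  rw [← isCoprime_map Complex.ofRealHom, isCoprime_iff_aeval_ne_zero_of_isAlgClosed ℂ ℂ]
  intro z
  rw [coe_aeval_eq_eval]
  by_contra! hz
  exact hij (h.eq_of_eval_eq_zero hz.1 hz.2)

end IsRootFactorization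

namespace IsHenselLift

variable {F : (PowerSeries ℝ)[X]} {Fs : Fin s → (PowerSeries ℝ)[X]}
  {Gs : Fin l → (PowerSeries ℝ)[X]}

theorem iff_elim : IsHenselLift F r m c n Fs Gs ↔ (∀ i, (Sum.elim Fs Gs i).Monic) ∧
    (∀ i, reductionModX (Sum.elim Fs Gs i) = rootFactor r m c n i) ∧
    F = ∏ i, Sum.elim Fs Gs i := by
  rw [Fintype.prod_sum_type]
  constructor
  · rintro ⟨h1, h2, h3, h4, h5⟩
    exact ⟨Sum.rec h1 h2, Sum.rec h3 h4, h5⟩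
  · rintro ⟨h1, h2, h3⟩
    exact ⟨fun i => h1 (.inl i), fun j => h1 (.inr j), fun i => h2 (.inl i),
      fun j => h2 (.inr j), h3⟩

theorem existsUnique (hF : F.Monic) (h : IsRootFactorization (reductionModX F) r m c n) :
    ∃! P : (Fin s → (PowerSeries ℝ)[X]) × (Fin l → (PowerSeries ℝ)[X]),
      IsHenselLift F r m c n P.1 P.2 := by
  obtain ⟨P, hP, hFP⟩ := exists_hensel_lift_prod Finset.univ hF
    (fun i _ => rootFactor_monic (r := r) (m := m) (c := c) (n := n) i)
    (fun i _ j _ hij => h.isCoprime_rootFactor hij) h.eq_prod_rootFactor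
  have hPe : Sum.elim (P ∘ Sum.inl) (P ∘ Sum.inr) = P := Sum.elim_comp_inl_inr P
  refine ⟨(P ∘ Sum.inl, P ∘ Sum.inr), ?_, ?_⟩
  · refine iff_elim.2 ?_
    rw [hPe]
    exact ⟨fun i => (hP i (Finset.mem_univ i)).1, fun i => (hP i (Finset.mem_univ i)).2, hFP⟩
  · rintro ⟨Fs, Gs⟩ hQ
    obtain ⟨hQ1, hQ2, hQ3⟩ := iff_elim.1 hQ
    have h1 : Sum.elim Fs Gs = P := by
      -- Both lifts have the same pairwise coprime reductions, so factors with different indices are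
      -- coprime.
      refine eq_of_prod_eq_prod_of_isCoprime hQ1 (fun i => (hP i (Finset.mem_univ i)).1) ?_
        (hQ3.symm.trans hFP)
      intro i j hij
      refine isCoprime_of_isCoprime_map (PowerSeries.constantCoeff (R := ℝ)) (hQ1 i)
        (hP j (Finset.mem_univ j)).1 ?_
      rw [(hP j (Finset.mem_univ j)).2]
      change IsCoprime (reductionModX _) _
      rw [hQ2 i]
      exact h.isCoprime_rootFactor hij
    rw [← h1, Sum.elim_comp_inl, Sum.elim_comp_inr]

/-- The constant term of `σ k` determines `κ k`; recording it as a root of the assigned factor is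
what later excludes real series from the `G_j`. -/
theorem exists_distribution (hL : IsHenselLift F r m c n Fs Gs)
    (h : IsRootFactorization (reductionModX F) r m c n) {N : ℕ+} {d : ℕ}
    {σ : Fin d → PowerSeries ℂ} (hσ : IsPuiseuxProduct F N σ Finset.univ) :
    ∃ κ : Fin d → Fin s ⊕ Fin l,
      (∀ i, IsPuiseuxProduct (Sum.elim Fs Gs i) N σ {k | κ k = i}) ∧
      ∀ k, ((rootFactor r m c n (κ k)).map Complex.ofRealHom).eval
        (PowerSeries.constantCoeff (σ k)) = 0 := by
  obtain ⟨hP1, hP2, hP3⟩ := iff_elim.1 hL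
  set P := Sum.elim Fs Gs
  have hFP : ∏ i, (P i).map (realExpand N) = ∏ k, (X - C (σ k)) := by
    rw [← Polynomial.map_prod, ← hP3, isPuiseuxProduct_iff.1 hσ]
  have hκ : ∀ k, ∃ i, ((rootFactor r m c n i).map Complex.ofRealHom).eval
      (PowerSeries.constantCoeff (σ k)) = 0 := by
    intro k
    have h1 : (∏ i, (P i).map (realExpand N)).eval (σ k) = 0 := by
      rw [hFP, eval_prod]
      exact Finset.prod_eq_zero (Finset.mem_univ k) (by simp)
    rw [eval_prod, Finset.prod_eq_zero_iff] at h1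
    obtain ⟨i, -, hi⟩ := h1
    refine ⟨i, ?_⟩
    rw [← hP2, eval_constantCoeff_reductionModX N, hi, map_zero]
  choose κ hκ using hκ
  refine ⟨κ, fun i => isPuiseuxProduct_iff.2 ?_, hκ⟩
  -- The lifted factors and the groups of linear factors are compared. Cross-coprimality holds
  -- because a common root of reductions would lie on two different factors of `f`.
  refine congrFun (eq_of_prod_eq_prod_of_isCoprime (P := fun i => (P i).map (realExpand N))
    (Q := fun i => ∏ k with κ k = i, (X - C (σ k))) (fun i => (hP1 i).map _)
    (fun i => monic_prod_of_monic _ _ fun k _ => monic_X_sub_C _) ?_ ?_) i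
  · intro i j hij
    refine IsCoprime.prod_right fun k hk => ?_
    refine isCoprime_of_isCoprime_map (PowerSeries.constantCoeff (R := ℂ)) ((hP1 i).map _)
      (monic_X_sub_C _) ?_
    rw [map_realExpand_map_constantCoeff, hP2, Polynomial.map_sub, map_X, map_C]
    refine (((irreducible_X_sub_C _).coprime_iff_not_dvd).2 fun hd => hij ?_).symm
    rw [← (Finset.mem_filter.1 hk).2]
    exact h.eq_of_eval_eq_zero (dvd_iff_isRoot.1 hd) (hκ k)
  · rw [hFP, Finset.prod_fiberwise]

theorem not_X_sub_C_puiseux_dvd (hL : IsHenselLift F r m c n Fs Gs)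
    (h : IsRootFactorization (reductionModX F) r m c n) (j : Fin l) (N : ℕ+) {τ : PowerSeries ℂ}
    (hτ : IsRealSeries τ) :
    ¬ X - C (puiseux N τ) ∣ (Gs j).map realPowerSeriesToHahn := by
  rw [X_sub_C_puiseux_dvd_iff]
  intro h0
  refine im_ne_zero_of_eval_conjPairFactor_eq_zero (h.nonreal j) (k := n j) ?_ hτ.im_constantCoeff
  rw [← hL.reduction_nonreal, eval_constantCoeff_reductionModX N, h0, map_zero]

end IsHenselLift

end MainTheorem

theorem mainTheorem5 (F : Polynomial (PowerSeries ℝ)) (hF : F.Monic) :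
    (∃ (s l : ℕ) (r : Fin s → ℝ) (m : Fin s → ℕ) (c : Fin l → ℂ) (n : Fin l → ℕ),
      IsRootFactorization (reductionModX F) r m c n) ∧
    (∃ (N : ℕ+) (σ : Fin F.natDegree → PowerSeries ℂ), IsPuiseuxProduct F N σ Finset.univ) ∧
    ∀ (s l : ℕ) (r : Fin s → ℝ) (m : Fin s → ℕ) (c : Fin l → ℂ) (n : Fin l → ℕ),
      IsRootFactorization (reductionModX F) r m c n →
      (∃! P : (Fin s → Polynomial (PowerSeries ℝ)) × (Fin l → Polynomial (PowerSeries ℝ)),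
        IsHenselLift F r m c n P.1 P.2) ∧
      ∀ (Fs : Fin s → Polynomial (PowerSeries ℝ)) (Gs : Fin l → Polynomial (PowerSeries ℝ)),
        IsHenselLift F r m c n Fs Gs →
        (∀ (N : ℕ+) (σ : Fin F.natDegree → PowerSeries ℂ),
          IsPuiseuxProduct F N σ Finset.univ →
          ∃ κ : Fin F.natDegree → Fin s ⊕ Fin l,
            (∀ i : Fin s, IsPuiseuxProduct (Fs i) N σ {k | κ k = Sum.inl i}) ∧
            (∀ j : Fin l, IsPuiseuxProduct (Gs j) N σ {k | κ k = Sum.inr j}) ∧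
            (∀ k, IsRealSeries (σ k) → ∃ i : Fin s, κ k = Sum.inl i)) ∧
        (∀ (j : Fin l) (N : ℕ+) (τ : PowerSeries ℂ), IsRealSeries τ →
          ¬ (Polynomial.X - Polynomial.C (puiseux N τ)) ∣ (Gs j).map realPowerSeriesToHahn) := by
  refine ⟨exists_isRootFactorization (hF.map _), exists_isPuiseuxProduct hF, ?_⟩
  intro s l r m c n h
  refine ⟨IsHenselLift.existsUnique hF h, fun Fs Gs hL => ⟨fun N σ hσ => ?_, fun j N τ hτ =>
    hL.not_X_sub_C_puiseux_dvd h j N hτ⟩⟩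
  obtain ⟨κ, hκ, hroot⟩ := hL.exists_distribution h hσ
  refine ⟨κ, fun i => ?_, fun j => ?_, fun k hk => ?_⟩
  · exact hκ (Sum.inl i)
  · exact hκ (Sum.inr j)
  · have h1 := hroot k
    rcases hκk : κ k with i | j
    · exact ⟨i, rfl⟩
    · rw [hκk] at h1
      exact absurd hk.im_constantCoeff
        (im_ne_zero_of_eval_conjPairFactor_eq_zero (h.nonreal j) h1)
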